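/- Let $K$ be a field, let $n>m\ge 2$ be integers, let $d=\gcd(n,m)$, and let $S=K[x_1,\ldots,x_n]$ with its standard $\mathbb Z^n$-grading. Let $J_{n,m}\subset S$ be the $m$-path ideal of the cycle graph of length $n$, i.e. the ideal generated by the $n$ monomials $x_ix_{i+1}\cdots x_{i+m-1}$, $1\le i\le n$, with indices taken modulo $n$. Let $t_0=t_0(n,m)$ be the maximal integer such that $t_0\le n-1$ and there exists a positive integer $\alpha$ with $$mt_0=\alpha n+d.$$ For a nonzero monomial ideal $I\subset S$, a Stanley decomposition of $I$ is a finite direct sum decomposition $\mathcal D: I=\bigoplus_{i=1}^r u_iK[Z_i]$ of $\mathbb Z^n$-graded $K$-vector spaces, where each $u_i\in I$ is nonzero and homogeneous with respect to the $\mathbb Z^n$-grading and $Z_i\subseteq\{x_1,\ldots,x_n\}$; the Stanley depth $\operatorname{sdepth}(I)$ is the maximum, over all Stanley decompositions $\mathcal D$ of $I$, of $\min_{1\le i\le r}|Z_i|$. Then, for every integer $t\ge t_0$, $$\operatorname{sdepth}(J_{n,m}^t)\le\left\lfloor\frac{n+d}{2}\right\rfloor .$$ -/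

import Mathlib

/-- A Stanley decomposition of an ideal `I` of `S = K[x_i : i ∈ σ]`, where `S` carries its standard
multigrading (so that a homogeneous element of `S` is a scalar multiple of a monomial):
a finite direct sum decomposition `I = ⨁ i, u_i K[Z_i]` into multigraded `K`-subspaces, with each
`u_i` homogeneous and `u_i K[Z_i]` a free `K[Z_i]`-module (which, `S` being a domain, means
`u_i ≠ 0`). -/
structure StanleyDecomposition {σ : Type*} {K : Type*} [Field K]
    (I : Ideal (MvPolynomial σ K)) where
  /-- the number of summands -/
  r : ℕ
  /-- the homogeneous generators of the summands -/
  u : Fin r → MvPolynomial σ K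
  /-- the sets of variables -/
  Z : Fin r → Finset σ
  homogeneous : ∀ i, ∃ (a : σ →₀ ℕ) (c : K), u i = MvPolynomial.monomial a c
  ne_zero : ∀ i, u i ≠ 0
  /-- the sum of the subspaces `u_i K[Z_i]` is direct -/
  independent : iSupIndep fun i =>
    (Subalgebra.toSubmodule (MvPolynomial.supported K (Z i : Set σ))).map
      (LinearMap.mulLeft K (u i))
  /-- the subspaces `u_i K[Z_i]` together span `I` -/
  iSup_eq : (⨆ i, (Subalgebra.toSubmodule (MvPolynomial.supported K (Z i : Set σ))).map
      (LinearMap.mulLeft K (u i))) = I.restrictScalars K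

/-- The Stanley depth of a decomposition, `min_i |Z_i|` (it is `⊤` only for the decomposition of the
zero ideal without summands). -/
noncomputable def StanleyDecomposition.sdepth {σ : Type*} {K : Type*} [Field K]
    {I : Ideal (MvPolynomial σ K)} (D : StanleyDecomposition I) : ℕ∞ :=
  ⨅ i, ((D.Z i).card : ℕ∞)

/-- The Stanley depth of an ideal: the maximum of the Stanley depths of its Stanley
decompositions. -/
noncomputable def Ideal.sdepth {σ : Type*} {K : Type*} [Field K]
    (I : Ideal (MvPolynomial σ K)) : ℕ∞ :=
  ⨆ D : StanleyDecomposition I, D.sdepth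

/-- The `m`-path ideal `J_{n,m}` of the `n`-cycle, generated by the `n` products
`x_i x_{i+1} ⋯ x_{i+m-1}` of `m` cyclically consecutive variables (indices modulo `n`; the
variables are numbered `0, …, n-1`). -/
noncomputable def cyclePathIdeal (K : Type*) [Field K] (n m : ℕ) :
    Ideal (MvPolynomial (Fin n) K) :=
  Ideal.span (Set.range fun i : Fin n =>
    ∏ j ∈ Finset.range m, MvPolynomial.X ⟨(i.val + j) % n, Nat.mod_lt _ i.pos⟩)

/-- The integers `t ≤ n - 1` such that `m t = α n + gcd(n, m)` for some positive integer `α`. -/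
def cycleThresholdSet (n m : ℕ) : Set ℕ :=
  {t | t ≤ n - 1 ∧ ∃ α : ℕ, 0 < α ∧ m * t = α * n + Nat.gcd n m}

/-- The integer `t₀(n, m)`: the largest element of `cycleThresholdSet n m`. -/
noncomputable def cycleThreshold (n m : ℕ) : ℕ :=
  sSup (cycleThresholdSet n m)

/-- For `n > m ≥ 2` the maximum defining `t₀(n, m)` exists. -/
theorem isGreatest_cycleThreshold (n m : ℕ) (hm : 2 ≤ m) (hmn : m < n) :
    IsGreatest (cycleThresholdSet n m) (cycleThreshold n m) := by
  have hbdd : BddAbove (cycleThresholdSet n m) := ⟨n - 1, fun t ht => ht.1⟩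
  refine ⟨Nat.sSup_mem ?_ hbdd, fun t ht => le_csSup hbdd ht⟩
  by_cases hdvd : m ∣ n
  · obtain ⟨k, rfl⟩ := hdvd
    have hk : 2 ≤ k := by
      by_contra h
      have : k ≤ 1 := by omega
      nlinarith
    obtain ⟨a, rfl⟩ : ∃ a, m = a + 1 := ⟨m - 1, by omega⟩
    refine ⟨1 + a * k, ?_, a, by omega, ?_⟩
    · apply Nat.le_sub_one_of_lt
      nlinarith
    · rw [Nat.gcd_eq_right (Dvd.intro k rfl)]
      ring
  · have hg : Nat.gcd m n < n := lt_of_le_of_lt (Nat.gcd_le_left n (by omega)) hmn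
    obtain ⟨s, hlt, hs⟩ := Nat.exists_mul_mod_eq_gcd hg
    have hdm := Nat.div_add_mod (m * s) n
    rw [hs] at hdm
    refine ⟨s, by omega, m * s / n, ?_, ?_⟩
    · rcases Nat.eq_zero_or_pos (m * s / n) with h0 | h0
      · exfalso
        rw [h0, mul_zero, zero_add] at hdm
        exact hdvd ((Dvd.intro _ hdm.symm).trans (Nat.gcd_dvd_right m n))
      · exact h0
    · rw [Nat.gcd_comm n m, mul_comm _ n]
      exact hdm.symm

/-! Split the variables into `d` classes by index modulo `d`. There is a monomial `x^w` such that
`x^w` times any choice of one variable per class lies in `J^t`, while `x^w x^c` lies in `J^t` only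
if `x^c` involves every class.

Such a `w` bounds the Stanley depth (`two_mul_le_card_add_card`). Among pairs (choice `J`, variable
`l` outside `J`), swapping `l` with the member of `J` in its class is an involution. In any
decomposition, a pair and its swap cannot both have the new variable free in the cell of their
choice, so `2(k - d) ≤ n - d`.

Membership comes from laying `t₀` windows around the cycle with `d` overlaps of one variable
(`exists_windows_sum_eq`). Necessity comes from degrees: every window contains equally many
variables of a given class (`le_classDegree_of_monomial_mem`). -/

/-- The exponents of the monomials of `x^a K[Z]`. -/
def stanleyCell {σ : Type*} (a : σ →₀ ℕ) (Z : Finset σ) : Set (σ →₀ ℕ) :=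
  {b | a ≤ b ∧ ∀ z ∉ Z, b z = a z}

/-! ### Stanley decompositions as partitions of the exponents of an ideal. -/

section Cells

open MvPolynomial

variable {σ K : Type*} [Field K]

theorem stanleyCell_mem_map {a b : σ →₀ ℕ} {c : K} (hc : c ≠ 0) {Z : Finset σ}
    (hb : b ∈ stanleyCell a Z) :
    monomial b (1 : K) ∈ (Subalgebra.toSubmodule (supported K (Z : Set σ))).map
      (LinearMap.mulLeft K (monomial a c)) := by
  refine ⟨monomial (b - a) c⁻¹, ?_, ?_⟩
  · simp only [SetLike.mem_coe, Subalgebra.mem_toSubmodule, mem_supported]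
    intro z hz
    by_contra hzZ
    rw [Finset.mem_coe, mem_vars_iff_mem_support] at hz
    obtain ⟨d, hd, hzd⟩ := hz
    have : d = b - a := by
      have := support_monomial_subset hd
      simpa using this
    subst this
    have := hb.2 z hzZ
    simp [this] at hzd
  · simp [monomial_mul, add_tsub_cancel_of_le hb.1, hc]

theorem support_subset_stanleyCell {a : σ →₀ ℕ} {c : K} {Z : Finset σ} {p : MvPolynomial σ K}
    (hp : p ∈ (Subalgebra.toSubmodule (supported K (Z : Set σ))).map
      (LinearMap.mulLeft K (monomial a c))) :
    (p.support : Set (σ →₀ ℕ)) ⊆ stanleyCell a Z := by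
  classical
  obtain ⟨q, hq, rfl⟩ := hp
  simp only [SetLike.mem_coe, Subalgebra.mem_toSubmodule, mem_supported] at hq
  intro b hb
  have hb' : coeff b (monomial a c * q) ≠ 0 := by simpa using hb
  rw [coeff_monomial_mul'] at hb'
  split_ifs at hb' with hab
  · refine ⟨hab, fun z hz => ?_⟩
    by_contra hne
    apply hz
    apply hq
    rw [Finset.mem_coe, mem_vars_iff_mem_support]
    refine ⟨b - a, mem_support_iff.2 (right_ne_zero_of_mul hb'), ?_⟩
    have := hab z
    simp only [Finsupp.mem_support_iff, Finsupp.coe_tsub, Pi.sub_apply]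
    omega
  · exact absurd rfl hb'

namespace StanleyDecomposition

variable {I : Ideal (MvPolynomial σ K)} (D : StanleyDecomposition I)

/-- The exponent of the generator of the `i`-th summand. -/
noncomputable def exponent (i : Fin D.r) : σ →₀ ℕ := (D.homogeneous i).choose

theorem exists_u_eq (i : Fin D.r) : ∃ c : K, c ≠ 0 ∧ D.u i = monomial (D.exponent i) c := by
  obtain ⟨c, hc⟩ := (D.homogeneous i).choose_spec
  refine ⟨c, ?_, hc⟩
  rintro rfl
  exact D.ne_zero i (by simpa using hc)

/-- The exponents of the monomials in the `i`-th summand. -/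
def cell (i : Fin D.r) : Set (σ →₀ ℕ) := stanleyCell (D.exponent i) (D.Z i)

theorem monomial_mem_of_mem_cell {i : Fin D.r} {b : σ →₀ ℕ} (hb : b ∈ D.cell i) :
    monomial b (1 : K) ∈ I := by
  obtain ⟨c, hc, hu⟩ := D.exists_u_eq i
  have h := stanleyCell_mem_map hc hb
  rw [← hu] at h
  have := D.iSup_eq ▸ (Submodule.mem_iSup_of_mem i h)
  simpa using this

theorem eq_of_mem_cell {i j : Fin D.r} {b : σ →₀ ℕ} (hi : b ∈ D.cell i) (hj : b ∈ D.cell j) :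
    i = j := by
  by_contra hij
  obtain ⟨c, hc, hu⟩ := D.exists_u_eq i
  obtain ⟨c', hc', hu'⟩ := D.exists_u_eq j
  have h := stanleyCell_mem_map hc hi
  have h' := stanleyCell_mem_map hc' hj
  rw [← hu] at h
  rw [← hu'] at h'
  have := Submodule.disjoint_def.1 (D.independent.pairwiseDisjoint hij) _ h h'
  simp at this

theorem exists_mem_cell {b : σ →₀ ℕ} (hb : monomial b (1 : K) ∈ I) : ∃ i, b ∈ D.cell i := by
  have hmem : monomial b (1 : K) ∈ restrictSupport K (⋃ i, D.cell i) := by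
    have hle : I.restrictScalars K ≤ restrictSupport K (⋃ i, D.cell i) := by
      rw [← D.iSup_eq]
      refine iSup_le fun i p hp => ?_
      obtain ⟨c, -, hu⟩ := D.exists_u_eq i
      rw [hu] at hp
      exact (support_subset_stanleyCell hp).trans (Set.subset_iUnion D.cell i)
    exact hle hb
  have : b ∈ ((monomial b (1 : K)).support : Set (σ →₀ ℕ)) := by
    classical simp [coeff_monomial]
  simpa using hmem this

end StanleyDecomposition

end Cells

/-! ### The exchange involution and the depth bound. -/

section Counting

open MvPolynomial

variable {σ ι : Type*}

/-- The exponent of the product of the variables chosen by `J`. -/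
noncomputable def choiceExponent [Fintype ι] (J : ι → σ) : σ →₀ ℕ := ∑ r, Finsupp.single (J r) 1

/-- Exchanging the value of `J` in the class of `l` with `l`. -/
def exchange [DecidableEq ι] (cls : σ → ι) (x : (ι → σ) × σ) : (ι → σ) × σ :=
  (Function.update x.1 (cls x.2) x.2, x.1 (cls x.2))

theorem exchange_exchange [DecidableEq ι] {cls : σ → ι} {x : (ι → σ) × σ} (hx : ∀ r, cls (x.1 r) = r) :
    exchange cls (exchange cls x) = x := by
  obtain ⟨J, l⟩ := x
  simp only at hx
  simp [exchange, hx]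

variable [Fintype ι] [DecidableEq ι]

theorem choiceExponent_eq_add (J : ι → σ) (r : ι) :
    choiceExponent J =
      (∑ s ∈ Finset.univ.erase r, Finsupp.single (J s) 1) + Finsupp.single (J r) 1 := by
  rw [choiceExponent, Finset.sum_erase_add _ _ (Finset.mem_univ r)]

theorem choiceExponent_update (J : ι → σ) (r : ι) (l : σ) :
    choiceExponent (Function.update J r l) =
      (∑ s ∈ Finset.univ.erase r, Finsupp.single (J s) 1) + Finsupp.single l 1 := by
  rw [choiceExponent_eq_add _ r, Function.update_self]
  congr 1
  refine Finset.sum_congr rfl fun s hs => ?_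
  rw [Function.update_of_ne (Finset.ne_of_mem_erase hs)]

/-- Double counting: each choice has at least `k - |ι|` free variables outside it, and the exchange
sends these pairs injectively to pairs that are not free. -/
theorem StanleyDecomposition.two_mul_le_card_add_card {K : Type*} [Field K] [Fintype σ]
    {I : Ideal (MvPolynomial σ K)} (D : StanleyDecomposition I) {k : ℕ}
    (hk : ∀ i, k ≤ (D.Z i).card) {cls : σ → ι} (hcls : Function.Surjective cls) (w : σ →₀ ℕ)
    (hmem : ∀ J : ι → σ, (∀ r, cls (J r) = r) → monomial (w + choiceExponent J) (1 : K) ∈ I)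
    (hcover : ∀ c : σ →₀ ℕ, monomial (w + c) (1 : K) ∈ I → ∀ r, ∃ l, cls l = r ∧ c l ≠ 0) :
    2 * k ≤ Fintype.card σ + Fintype.card ι := by
  classical
  have hle : Fintype.card ι ≤ Fintype.card σ := Fintype.card_le_of_surjective _ hcls
  let G : Finset (ι → σ) := Finset.univ.filter fun J => ∀ r, cls (J r) = r
  have hG : ∀ {J}, J ∈ G ↔ ∀ r, cls (J r) = r := by simp [G]
  have hGpos : 0 < G.card := by
    choose J hJ using hcls
    exact Finset.card_pos.2 ⟨J, hG.2 hJ⟩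
  have hidx : ∀ J : ι → σ, ∃ i, J ∈ G → w + choiceExponent J ∈ D.cell i := by
    intro J
    by_cases hJ : J ∈ G
    · obtain ⟨i, hi⟩ := D.exists_mem_cell (hmem J (hG.1 hJ))
      exact ⟨i, fun _ => hi⟩
    · choose J' hJ' using hcls
      obtain ⟨i, -⟩ := D.exists_mem_cell (hmem J' hJ')
      exact ⟨i, fun h => absurd h hJ⟩
  choose idx hidx using hidx
  have himage : ∀ J ∈ G, ∀ l, l = J (cls l) ↔ l ∈ Finset.univ.image J := by
    intro J hJ l
    simp only [Finset.mem_image, Finset.mem_univ, true_and]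
    constructor
    · exact fun h => ⟨_, h.symm⟩
    · rintro ⟨r, rfl⟩
      rw [hG.1 hJ r]
  have hcard : ∀ J ∈ G, (Finset.univ.image J).card = Fintype.card ι := fun J hJ =>
    Finset.card_image_of_injective _ (Function.LeftInverse.injective (hG.1 hJ))
  -- `B` holds all pairs with `l` outside `J`; `A` keeps those where `l` is free in the cell
  -- containing `w + choiceExponent J`.
  let B : Finset ((_ : ι → σ) × σ) := G.sigma fun J => (Finset.univ.image J)ᶜ
  let A : Finset ((_ : ι → σ) × σ) := G.sigma fun J => D.Z (idx J) \ Finset.univ.image J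
  let τ : ((_ : ι → σ) × σ) → ((_ : ι → σ) × σ) := fun x =>
    ⟨(exchange cls (x.1, x.2)).1, (exchange cls (x.1, x.2)).2⟩
  have hττ : ∀ x : (_ : ι → σ) × σ, x.1 ∈ G → τ (τ x) = x := by
    intro x hx
    have := exchange_exchange (x := (x.1, x.2)) (hG.1 hx)
    simp only [τ, Prod.mk.eta, this]
  have hAB : A ⊆ B := by
    intro x hx
    simp only [A, B, Finset.mem_sigma, Finset.mem_sdiff, Finset.mem_compl] at hx ⊢
    exact ⟨hx.1, hx.2.2⟩
  have hτG : ∀ x : (_ : ι → σ) × σ, x.1 ∈ G → (τ x).1 ∈ G := by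
    intro x hx
    rw [hG]
    intro r
    by_cases hr : r = cls x.2
    · subst hr
      simp [τ, exchange]
    · simp [τ, exchange, Function.update_of_ne hr, hG.1 hx r]
  have hτB : ∀ x ∈ B, τ x ∈ B := by
    intro x hx
    simp only [B, Finset.mem_sigma, Finset.mem_compl] at hx ⊢
    refine ⟨hτG x hx.1, ?_⟩
    rw [← himage _ (hτG x hx.1)]
    rw [← himage _ hx.1] at hx
    intro h
    apply hx.2
    simpa [τ, exchange, hG.1 hx.1, eq_comm] using h
  have hinj : Set.InjOn τ A := by
    intro x hx y hy hxy
    have hx' := (Finset.mem_sigma.1 hx).1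
    have hy' := (Finset.mem_sigma.1 hy).1
    rw [← hττ x hx', hxy, hττ y hy']
  have hdisj : Disjoint A (A.image τ) := by
    rw [Finset.disjoint_left]
    intro y hy hyA
    obtain ⟨⟨J, l⟩, hx, rfl⟩ := Finset.mem_image.1 hyA
    have hyB := hAB hy
    simp only [A, Finset.mem_sigma, Finset.mem_sdiff] at hx hy
    obtain ⟨hJ, hlZ, hlJ⟩ := hx
    obtain ⟨hJ', hlZ', -⟩ := hy
    rw [← himage J hJ] at hlJ
    set J' := (τ ⟨J, l⟩).1 with hJ'def
    set r := cls l with hr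
    set c : σ →₀ ℕ := ∑ s ∈ Finset.univ.erase r, Finsupp.single (J s) 1 with hc
    have h1 : choiceExponent J = c + Finsupp.single (J r) 1 := choiceExponent_eq_add J r
    have h2 : choiceExponent J' = c + Finsupp.single l 1 := choiceExponent_update J r l
    have hi := hidx J hJ
    have hi' := hidx J' hJ'
    have hlZ2 : J r ∈ D.Z (idx J') := hlZ'
    have hadd : ∀ {i z} {b : σ →₀ ℕ}, b ∈ D.cell i → z ∈ D.Z i →
        b + Finsupp.single z 1 ∈ D.cell i := by
      intro i z b hb hz
      refine ⟨hb.1.trans le_self_add, fun y hy => ?_⟩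
      have : z ≠ y := by rintro rfl; exact hy hz
      simp [hb.2 y hy, this]
    have e1 := hadd hi hlZ
    have e2 := hadd hi' hlZ2
    -- Both cells contain this common multiple, hence they coincide.
    have heq : w + choiceExponent J + Finsupp.single l 1 =
        w + choiceExponent J' + Finsupp.single (J r) 1 := by
      rw [h1, h2]; abel
    have hij : idx J = idx J' := D.eq_of_mem_cell e1 (heq ▸ e2)
    rw [← hij] at hi'
    -- `w + c` is the meet of the two exponents, and a cell is closed under meets; but `c` has lost
    -- its only variable of class `r`.
    have hval : ∀ z, (w + c) z = (w + choiceExponent J) z ∨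
        (w + c) z = (w + choiceExponent J') z := by
      intro z
      by_cases hz : z = l
      · left
        have : J r ≠ z := by rw [hz]; exact fun h => hlJ h.symm
        simp [h1, this]
      · right
        have : l ≠ z := fun h => hz h.symm
        simp [h2, this]
    have hwc : w + c ∈ D.cell (idx J) := by
      refine ⟨fun z => ?_, fun z hz => ?_⟩
      · rcases hval z with h | h
        · rw [h]; exact hi.1 z
        · rw [h]; exact hi'.1 z
      · rcases hval z with h | h
        · rw [h]; exact hi.2 z hz
        · rw [h]; exact hi'.2 z hz
    obtain ⟨z, hz, hcz⟩ := hcover c (D.monomial_mem_of_mem_cell hwc) r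
    apply hcz
    rw [hc, Finsupp.finsetSum_apply]
    refine Finset.sum_eq_zero fun s hs => ?_
    refine Finsupp.single_eq_of_ne ?_
    rintro rfl
    rw [hG.1 hJ s] at hz
    exact Finset.ne_of_mem_erase hs hz
  have hAB2 : 2 * A.card ≤ B.card := by
    have h : A ∪ A.image τ ⊆ B := Finset.union_subset hAB
      (Finset.image_subset_iff.2 fun x hx => hτB x (hAB hx))
    have := Finset.card_le_card h
    rw [Finset.card_union_of_disjoint hdisj, Finset.card_image_of_injOn hinj] at this
    omega
  have hBcard : B.card = G.card * (Fintype.card σ - Fintype.card ι) := by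
    rw [Finset.card_sigma, Finset.sum_const_nat]
    intro J hJ
    rw [Finset.card_compl, hcard J hJ]
  have hAcard : G.card * (k - Fintype.card ι) ≤ A.card := by
    rw [Finset.card_sigma, ← smul_eq_mul]
    refine Finset.card_nsmul_le_sum _ _ _ fun J hJ => ?_
    have := Finset.le_card_sdiff (Finset.univ.image J) (D.Z (idx J))
    rw [hcard J hJ] at this
    exact (Nat.sub_le_sub_right (hk _) _).trans this
  have : G.card * (2 * (k - Fintype.card ι)) ≤
      G.card * (Fintype.card σ - Fintype.card ι) := by
    rw [← hBcard]; nlinarith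
  have := Nat.le_of_mul_le_mul_left this hGpos
  omega

theorem Ideal.sdepth_le_of_forall_choice {K : Type*} [Field K] [Fintype σ]
    (I : Ideal (MvPolynomial σ K)) {cls : σ → ι} (hcls : Function.Surjective cls) (w : σ →₀ ℕ)
    (hmem : ∀ J : ι → σ, (∀ r, cls (J r) = r) → monomial (w + choiceExponent J) (1 : K) ∈ I)
    (hcover : ∀ c : σ →₀ ℕ, monomial (w + c) (1 : K) ∈ I → ∀ r, ∃ l, cls l = r ∧ c l ≠ 0) :
    I.sdepth ≤ (((Fintype.card σ + Fintype.card ι) / 2 : ℕ) : ℕ∞) := by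
  refine iSup_le fun D => ?_
  by_contra! hlt
  have hk : ∀ i, (Fintype.card σ + Fintype.card ι) / 2 + 1 ≤ (D.Z i).card := by
    intro i
    have := hlt.trans_le (iInf_le _ i)
    exact_mod_cast this
  have := D.two_mul_le_card_add_card hk hcls w hmem hcover
  omega

end Counting

/-! ### Covering the cycle by windows with prescribed overlaps. -/

section Walk

theorem Nat.exists_modEq_add_mul {n m : ℕ} (hn : 0 < n) {x y : ℕ}
    (hxy : x ≡ y [MOD n.gcd m]) :
    ∃ l, 1 ≤ l ∧ l ≤ n / n.gcd m ∧ x + m * l ≡ y [MOD n] := by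
  set d := n.gcd m with hd
  have hdpos : 0 < d := Nat.gcd_pos_of_pos_left m hn
  obtain ⟨N, hN⟩ : d ∣ n := Nat.gcd_dvd_left n m
  obtain ⟨M, hM⟩ : d ∣ m := Nat.gcd_dvd_right n m
  have hNpos : 0 < N := Nat.pos_of_mul_pos_left (hN ▸ hn)
  obtain ⟨e, he⟩ := hxy.dvd
  have hbez := Nat.gcd_eq_gcd_ab n m
  rw [← hd] at hbez
  -- The shift by one puts `l = v + 1` in `[1, N]` instead of `[0, N - 1]`.
  set v := (n.gcdB m * e - 1) % (N : ℤ) with hv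
  have hv0 : 0 ≤ v := Int.emod_nonneg _ (by omega)
  have hvN : v < N := Int.emod_lt_of_pos _ (by omega)
  obtain ⟨q, hq⟩ : (N : ℤ) ∣ (n.gcdB m * e - 1) - v := Int.dvd_self_sub_emod
  refine ⟨v.toNat + 1, by omega, ?_, ?_⟩
  · rw [hN, Nat.mul_div_cancel_left _ hdpos]; omega
  · rw [← Int.natCast_modEq_iff, Int.modEq_iff_dvd]
    push_cast
    rw [Int.toNat_of_nonneg hv0]
    refine ⟨n.gcdA m * e + M * q, ?_⟩
    have hm' : (m : ℤ) = d * M := by exact_mod_cast hM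
    have hn' : (n : ℤ) = d * N := by exact_mod_cast hN
    have h3 : (m : ℤ) * N = n * M := by rw [hm', hn']; ring
    linear_combination he + e * hbez + (m : ℤ) * hq + q * h3

variable {M : Type*} [AddCommMonoid M]

/-- The sum of the values of `e` on a window of length `m`. -/
def windowSum (e : ℕ → M) (m s : ℕ) : M := ∑ j ∈ Finset.range m, e (s + j)

/-- Prefix sums stand on both sides because `M` has no subtraction. -/
theorem exists_windows_append (e : ℕ → M) (m p l : ℕ) :
    ∃ s : Multiset ℕ, s.card = l ∧ (s.map (windowSum e m)).sum + ∑ k ∈ Finset.range p, e k =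
      ∑ k ∈ Finset.range (p + m * l), e k := by
  induction l with
  | zero => exact ⟨0, by simp⟩
  | succ l ih =>
    obtain ⟨s, hs, hsum⟩ := ih
    refine ⟨(p + m * l) ::ₘ s, by simp [hs], ?_⟩
    rw [Multiset.map_cons, Multiset.sum_cons, add_assoc, hsum, windowSum, mul_add, mul_one,
      ← add_assoc, Finset.sum_range_add e (p + m * l) m, add_comm]

/-- Walking around the cycle in windows of length `m`, stepping back by one after having reached
each of `J 1, …, J k`. -/
theorem exists_windows_walk (e : ℕ → M) {n m : ℕ} (hn : 0 < n) (hm : 0 < m)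
    (he : ∀ x y, x ≡ y [MOD n] → e x = e y) (J : ℕ → ℕ) (hJ : ∀ k, n.gcd m ∣ J k + k) (k : ℕ) :
    ∃ (p : ℕ) (s : Multiset ℕ), s.card ≤ k * (n / n.gcd m) ∧ p ≡ J k [MOD n] ∧
      p + k = J 0 + m * s.card ∧
      (s.map (windowSum e m)).sum + ∑ i ∈ Finset.range (J 0), e i =
        ∑ i ∈ Finset.range p, e i + ∑ i ∈ Finset.range k, e (J (i + 1)) := by
  induction k with
  | zero => exact ⟨J 0, 0, by simp, rfl, by simp, by simp⟩
  | succ k ih =>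
    obtain ⟨p, s, hcard, hp, hlen, hsum⟩ := ih
    -- Windows preserve the position modulo `d` and each step back lowers it by one, which is why `J
    -- k ≡ -k` is required.
    have hmod : p ≡ J (k + 1) + 1 [MOD n.gcd m] := by
      refine (hp.of_dvd (Nat.gcd_dvd_left n m)).trans ?_
      refine Nat.ModEq.add_right_cancel' k ?_
      refine ((Nat.modEq_zero_iff_dvd.2 (hJ k)).trans
        (Nat.modEq_zero_iff_dvd.2 (hJ (k + 1))).symm).trans ?_
      rw [show J (k + 1) + 1 + k = J (k + 1) + (k + 1) by ring]
    obtain ⟨l, hl1, hlN, hl⟩ := Nat.exists_modEq_add_mul hn hmod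
    obtain ⟨s', hs', hsum'⟩ := exists_windows_append e m p l
    -- At least one window is laid, so stepping back stays in `ℕ`.
    have hml : 1 ≤ m * l := Nat.mul_pos hm hl1
    obtain ⟨p', hp'⟩ : ∃ p', p + m * l = p' + 1 := ⟨p + m * l - 1, by omega⟩
    have hp'J : p' ≡ J (k + 1) [MOD n] := by
      rw [hp'] at hl
      exact Nat.ModEq.add_right_cancel' 1 hl
    refine ⟨p', s + s', ?_, hp'J, ?_, ?_⟩
    · rw [Multiset.card_add, hs', add_mul, one_mul]; omega
    · rw [Multiset.card_add, hs', mul_add]; omega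
    · rw [Multiset.map_add, Multiset.sum_add, add_right_comm, hsum, add_right_comm,
        add_comm _ (Multiset.sum _), hsum', hp', Finset.sum_range_succ, Finset.sum_range_succ,
        he _ _ hp'J]
      abel

/-- Start at `J 0`, step back at `J 1, …, J (d - 1)`, and spend the remaining windows: `m t = α n +
d` forces the walk to end just past `J 0`, so each `J i` is covered once more than the `α` full
turns account for. -/
theorem exists_windows_sum_eq [IsCancelAdd M] (e : ℕ → M) {n m t α : ℕ} (hn : 0 < n) (hm : 0 < m)
    (he : ∀ x y, x ≡ y [MOD n] → e x = e y) (J : ℕ → ℕ) (hJ : ∀ k, n.gcd m ∣ J k + k)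
    (ht : n ≤ t + n / n.gcd m) (hα : m * t = α * n + n.gcd m) :
    ∃ s : Multiset ℕ, s.card = t ∧ (s.map (windowSum e m)).sum =
      α • ∑ i ∈ Finset.range n, e i + ∑ i ∈ Finset.range (n.gcd m), e (J i) := by
  set d := n.gcd m with hd
  obtain ⟨d', hd'⟩ : ∃ d', d = d' + 1 :=
    Nat.exists_eq_succ_of_ne_zero (Nat.gcd_pos_of_pos_left m hn).ne'
  obtain ⟨p, s, hcard, hp, hlen, hsum⟩ := exists_windows_walk e hn hm he J hJ d'
  rw [← hd] at hcard
  have hnN : (d' + 1) * (n / d) = n := by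
    rw [← hd']; exact Nat.mul_div_cancel' (Nat.gcd_dvd_left n m)
  -- The `d - 1` legs use at most `(d - 1) n / d = n - n / d` windows.
  have hst : s.card ≤ t := by
    rw [add_mul, one_mul] at hnN; omega
  obtain ⟨s', hs', hsum'⟩ := exists_windows_append e m p (t - s.card)
  refine ⟨s + s', by rw [Multiset.card_add, hs']; omega, ?_⟩
  have hend : p + m * (t - s.card) = J 0 + α * n + 1 := by
    have : m * (t - s.card) + m * s.card = m * t := by rw [← mul_add]; congr 1; omega
    omega
  have hturn : ∀ a x, ∑ i ∈ Finset.range (x + a * n), e i =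
      ∑ i ∈ Finset.range x, e i + a • ∑ i ∈ Finset.range n, e i := by
    intro a x
    induction a with
    | zero => simp
    | succ a ih =>
      rw [show x + (a + 1) * n = n + (x + a * n) by ring, Finset.sum_range_add,
        Finset.sum_congr rfl fun i _ => he (n + i) i (by simp [Nat.ModEq]), ih, succ_nsmul]
      abel
  apply add_right_cancel (b := ∑ i ∈ Finset.range (J 0), e i)
  rw [Multiset.map_add, Multiset.sum_add, add_right_comm, hsum, add_right_comm,
    add_comm _ (Multiset.sum _), hsum', hend, Finset.sum_range_succ, hturn,
    he (J 0 + α * n) (J 0) (by simp [Nat.ModEq]), hd', Finset.sum_range_succ']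
  abel

end Walk

/-! ### Powers of the path ideal and degrees in residue classes. -/

section CyclePathIdeal

open MvPolynomial

variable (K : Type*) [Field K] {n : ℕ}

/-- The exponent of the variable with index `s` modulo `n`. -/
noncomputable def cycleExponent (hn : 0 < n) (s : ℕ) : Fin n →₀ ℕ :=
  Finsupp.single ⟨s % n, Nat.mod_lt _ hn⟩ 1

theorem cycleExponent_congr (hn : 0 < n) {x y : ℕ} (h : x ≡ y [MOD n]) :
    cycleExponent hn x = cycleExponent hn y := by
  unfold cycleExponent
  congr 2

theorem monomial_windowSum (hn : 0 < n) (m s : ℕ) :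
    monomial (windowSum (cycleExponent hn) m s) (1 : K) =
      ∏ j ∈ Finset.range m, X ⟨(s + j) % n, Nat.mod_lt _ hn⟩ := by
  rw [windowSum, monomial_sum_one]
  rfl

theorem monomial_windowSum_mem (hn : 0 < n) (m s : ℕ) :
    monomial (windowSum (cycleExponent hn) m s) (1 : K) ∈ cyclePathIdeal K n m := by
  rw [monomial_windowSum]
  refine Ideal.subset_span ⟨⟨s % n, Nat.mod_lt _ hn⟩, ?_⟩
  simp

theorem monomial_sum_windows_mem (hn : 0 < n) (m : ℕ) (s : Multiset ℕ) :
    monomial (s.map (windowSum (cycleExponent hn) m)).sum (1 : K) ∈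
      cyclePathIdeal K n m ^ s.card := by
  induction s using Multiset.induction_on with
  | empty => simp
  | cons a s ih =>
    rw [Multiset.map_cons, Multiset.sum_cons, Multiset.card_cons, pow_succ', ← one_mul (1 : K),
      ← monomial_mul]
    exact Ideal.mul_mem_mul (monomial_windowSum_mem K hn m a) ih

/-- The negative of the residue class of an index. -/
def negClass (d : ℕ) (l : Fin n) : ZMod d := -(l.val : ZMod d)

/-- The degree of an exponent in the variables of a given class. -/
noncomputable def classDegree (d : ℕ) (r : ZMod d) : (Fin n →₀ ℕ) →+ ℕ :=
  Finsupp.weight fun l => if negClass d l = r then 1 else 0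

theorem classDegree_cycleExponent {d : ℕ} (hdn : d ∣ n) (hn : 0 < n) (r : ZMod d) (s : ℕ) :
    classDegree d r (cycleExponent hn s) = if -(s : ZMod d) = r then 1 else 0 := by
  have : ((s % n : ℕ) : ZMod d) = s := by
    rw [ZMod.natCast_eq_natCast_iff]
    exact (Nat.mod_modEq s n).of_dvd hdn
  simp [classDegree, cycleExponent, Finsupp.weight_single, negClass, this]

/-- Since `d ∣ m`, residues are `m`-periodic, so the count does not depend on where the window
starts. -/
theorem classDegree_windowSum {d m : ℕ} (hdn : d ∣ n) (hdm : d ∣ m) (hn : 0 < n) (r : ZMod d)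
    (s : ℕ) : classDegree d r (windowSum (cycleExponent hn) m s) =
      m.count fun x => -(x : ZMod d) = r := by
  have hper : Function.Periodic (fun x : ℕ => -(x : ZMod d) = r) m := by
    intro x
    simp [(ZMod.natCast_eq_zero_iff m d).2 hdm]
  rw [← Nat.filter_Ico_card_eq_of_periodic s m _ hper, windowSum, map_sum, Finset.card_filter,
    Finset.sum_Ico_eq_sum_range, Nat.add_sub_cancel_left]
  exact Finset.sum_congr rfl fun j _ => classDegree_cycleExponent hdn hn r (s + j)

theorem aeval_monomial_classDegree (d : ℕ) (r : ZMod d) (b : Fin n →₀ ℕ) :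
    aeval (fun l : Fin n => (Polynomial.X : Polynomial K) ^ (if negClass d l = r then 1 else 0))
      (monomial b (1 : K)) = Polynomial.X ^ classDegree d r b := by
  rw [aeval_monomial, map_one, one_mul, classDegree, Finsupp.weight_apply, Finsupp.prod,
    Finsupp.sum, ← Finset.prod_pow_eq_pow_sum]
  refine Finset.prod_congr rfl fun l _ => ?_
  rw [← pow_mul, smul_eq_mul, mul_comm]

/-- Send the variables of class `r` to `X` and the others to `1`: the ideal lands in `(X^q)`, and
its `t`-th power in `(X^(q t))`. -/
theorem le_classDegree_of_monomial_mem {d m : ℕ} (hdn : d ∣ n) (hdm : d ∣ m) (hn : 0 < n)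
    (r : ZMod d) {t : ℕ} {b : Fin n →₀ ℕ} (hb : monomial b (1 : K) ∈ cyclePathIdeal K n m ^ t) :
    t * (m.count fun x => -(x : ZMod d) = r) ≤ classDegree d r b := by
  set φ := aeval (R := K) fun l : Fin n =>
    (Polynomial.X : Polynomial K) ^ (if negClass d l = r then 1 else 0) with hφ
  set q := m.count fun x => -(x : ZMod d) = r with hq
  have hmap : (cyclePathIdeal K n m).map φ ≤ Ideal.span {Polynomial.X ^ q} := by
    rw [cyclePathIdeal, Ideal.map_span, Ideal.span_le]
    rintro _ ⟨_, ⟨i, rfl⟩, rfl⟩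
    have h1 := monomial_windowSum K hn m i.val
    have h2 := aeval_monomial_classDegree K d r (windowSum (cycleExponent hn) m i.val)
    rw [h1, classDegree_windowSum hdn hdm hn] at h2
    rw [SetLike.mem_coe, h2]
    exact Ideal.mem_span_singleton_self _
  have h := Ideal.mem_map_of_mem φ hb
  rw [Ideal.map_pow] at h
  have h' := Ideal.pow_right_mono hmap t h
  rw [Ideal.span_singleton_pow, Ideal.mem_span_singleton, hφ, aeval_monomial_classDegree,
    ← pow_mul] at h'
  rw [mul_comm]
  exact (pow_dvd_pow_iff Polynomial.X_ne_zero Polynomial.not_isUnit_X).1 h'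

theorem classDegree_choiceExponent {d : ℕ} [NeZero d] {J : ZMod d → Fin n}
    (hJ : ∀ r, negClass d (J r) = r) (r : ZMod d) :
    classDegree d r (choiceExponent J) = 1 := by
  simp [classDegree, choiceExponent, Finsupp.weight_single, hJ]

theorem exists_ne_zero_of_classDegree_pos {d : ℕ} {r : ZMod d} {c : Fin n →₀ ℕ}
    (hc : 0 < classDegree d r c) : ∃ l, negClass d l = r ∧ c l ≠ 0 := by
  by_contra! h
  apply hc.ne'
  rw [classDegree, Finsupp.weight_apply, Finsupp.sum]
  refine Finset.sum_eq_zero fun l _ => ?_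
  by_cases hl : negClass d l = r
  · simp [h l hl]
  · simp [hl]

theorem choiceExponent_eq_sum_range (hn : 0 < n) {d : ℕ} [NeZero d] (J : ZMod d → Fin n) :
    choiceExponent J = ∑ i ∈ Finset.range d, cycleExponent hn (J (i : ZMod d)).val := by
  have h : ∀ l : Fin n, cycleExponent hn l.val = Finsupp.single l 1 := by
    intro l
    simp [cycleExponent, Nat.mod_eq_of_lt l.isLt]
  simp only [h, choiceExponent]
  symm
  refine Finset.sum_bij' (fun i _ => (i : ZMod d)) (fun r _ => r.val) ?_ ?_ ?_ ?_ ?_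
  · simp
  · intro r _
    simpa using ZMod.val_lt r
  · intro i hi
    exact ZMod.val_cast_of_lt (Finset.mem_range.1 hi)
  · simp
  · simp

theorem negClass_surjective {d : ℕ} [NeZero d] (hdn : d ≤ n) :
    Function.Surjective (negClass d : Fin n → ZMod d) := by
  intro r
  exact ⟨⟨(-r).val, (ZMod.val_lt _).trans_le hdn⟩, by simp [negClass]⟩

/-- Adding `n / d` to a solution `t` of `m t = α n + d` gives another, with `α + m / d`; maximality
of `t₀` pushes it beyond `n - 1`. -/
theorem le_cycleThreshold_add (n m : ℕ) (hm : 2 ≤ m) (hmn : m < n) :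
    n ≤ cycleThreshold n m + n / n.gcd m := by
  obtain ⟨⟨hle, α, hα, heq⟩, hub⟩ := isGreatest_cycleThreshold n m hm hmn
  by_contra! hlt
  have hd : 0 < n.gcd m := Nat.gcd_pos_of_pos_left m (by omega)
  obtain ⟨M, hM⟩ := Nat.gcd_dvd_right n m
  have hN : n.gcd m * (n / n.gcd m) = n := Nat.mul_div_cancel' (Nat.gcd_dvd_left n m)
  have hpos : 0 < n / n.gcd m := Nat.div_pos (Nat.gcd_le_left m (by omega)) hd
  have hmN : m * (n / n.gcd m) = M * n := by
    calc m * (n / n.gcd m) = n.gcd m * M * (n / n.gcd m) := by rw [← hM]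
      _ = M * (n.gcd m * (n / n.gcd m)) := by ring
      _ = M * n := by rw [hN]
  have := hub (a := cycleThreshold n m + n / n.gcd m)
    ⟨by omega, α + M, by omega, by rw [mul_add, heq, hmN]; ring⟩
  omega

end CyclePathIdeal

theorem theorem4p5 (K : Type*) [Field K] (n m : ℕ) (hm : 2 ≤ m) (hmn : m < n)
    (t : ℕ) (ht : cycleThreshold n m ≤ t) :
    Ideal.sdepth (cyclePathIdeal K n m ^ t) ≤ (((n + Nat.gcd n m) / 2 : ℕ) : ℕ∞) := by
  have hn : 0 < n := by omega
  obtain ⟨⟨-, α, -, hα⟩, -⟩ := isGreatest_cycleThreshold n m hm hmn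
  have hN := le_cycleThreshold_add n m hm hmn
  have hdn : n.gcd m ∣ n := Nat.gcd_dvd_left n m
  have hdm : n.gcd m ∣ m := Nat.gcd_dvd_right n m
  have : NeZero (n.gcd m) := ⟨(Nat.gcd_pos_of_pos_left m hn).ne'⟩
  have hsurj := negClass_surjective (Nat.le_of_dvd hn hdn)
  -- The `α` full turns left by the walk, padded with copies of one fixed window to pass from `t₀`
  -- to `t`.
  set w : Fin n →₀ ℕ := α • ∑ i ∈ Finset.range n, cycleExponent hn i +
    (t - cycleThreshold n m) • windowSum (cycleExponent hn) m 0 with hw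
  have hwindows : ∀ J : ZMod (n.gcd m) → Fin n, (∀ r, negClass (n.gcd m) (J r) = r) →
      ∃ s : Multiset ℕ, s.card = t ∧
        (s.map (windowSum (cycleExponent hn) m)).sum = w + choiceExponent J := by
    intro J hJ
    obtain ⟨s, hs, hsum⟩ := exists_windows_sum_eq (cycleExponent hn) hn (by omega)
      (fun x y => cycleExponent_congr hn) (fun k => (J (k : ZMod (n.gcd m))).val)
      (fun k => by
        rw [← ZMod.natCast_eq_zero_iff, Nat.cast_add]
        have := hJ (k : ZMod (n.gcd m))
        rw [negClass, neg_eq_iff_add_eq_zero] at this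
        exact this) hN hα
    refine ⟨s + Multiset.replicate (t - cycleThreshold n m) 0, ?_, ?_⟩
    · rw [Multiset.card_add, hs, Multiset.card_replicate]; omega
    · rw [Multiset.map_add, Multiset.sum_add, hsum, Multiset.map_replicate,
        Multiset.sum_replicate, choiceExponent_eq_sum_range hn, hw]
      abel
  have key := (cyclePathIdeal K n m ^ t).sdepth_le_of_forall_choice hsurj w ?_ ?_
  · simpa [ZMod.card] using key
  · intro J hJ
    obtain ⟨s, hs, hsum⟩ := hwindows J hJ
    rw [← hsum, ← hs]
    exact monomial_sum_windows_mem K hn m s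
  · intro c hc r
    -- Any choice shows that `w` has class degree exactly one below the minimum for `J^t`, so `c`
    -- must supply the difference.
    obtain ⟨J, hJ⟩ := hsurj.hasRightInverse
    obtain ⟨s, hs, hsum⟩ := hwindows J hJ
    have h1 := congrArg (classDegree (n.gcd m) r) hsum
    rw [map_multiset_sum, Multiset.map_map, map_add, classDegree_choiceExponent hJ] at h1
    simp only [Function.comp_def, classDegree_windowSum hdn hdm hn, Multiset.map_const',
      Multiset.sum_replicate, hs, smul_eq_mul] at h1
    have h2 := le_classDegree_of_monomial_mem K hdn hdm hn r hc
    rw [map_add] at h2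
    exact exists_ne_zero_of_classDegree_pos (by omega)
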